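/- Let $G=(V,E)$ be a finite undirected network with $m=|V|\ge 1$ users, let $D\subseteq V$ be a dominating set of $G$ (every node outside $D$ is adjacent to a node of $D$), and let a dominating set partition based on $D$ be given: a partition of $V$ into $|D|$ components, each consisting of one node of $D$ and some of its neighbours. All users face the same stochastic bandit problem with arms $1,\dots,K$ ($K\ge 1$), where arm $i$ has a reward distribution on $[0,1]$ with mean $\mu_i$; the rewards $X^v_i(t)$, over all users $v$, arms $i$ and rounds $t$, are independent, $X^v_i(t)$ having the distribution of arm $i$. Put $\mu^*=\max_i\mu_i$ and $\Delta_i=\mu^*-\mu_i$. In each round every user $v$ plays one arm, $a^v(t)$, receives the reward $X^v_{a^v(t)}(t)$, and before the next round has seen the actions and rewards of itself and its neighbours. The network runs the Follow Your Leader (FYL) policy. Each leader $v\in D$ plays arm $t$ in round $t$ for $1\le t\le K$, and for $t\ge K$ plays in round $t+1$ an arm $j$ that maximizes $\hat\mu_j(t)+\sqrt{2\ln t/m_j(t)}$ (ties broken arbitrarily on the basis of what $v$ knows), where $m_j(t)$ is the number of times that arm $j$ was played in the component of $v$ in rounds $1,\dots,t$, and $\hat\mu_j(t)$ is the average of the corresponding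 rewards. Each follower $v\in V\setminus D$ plays in round $1$ a random arm (the random arms of the users may have any joint law, but are independent of the rewards), and in every round $t>1$ the arm that the leader of its component played in round $t-1$. Then, for every horizon $n$ and every $\beta\in(1/4,1)$, the expected network regret $\mathbb{E}[R^G(n)]=\mathbb{E}\big[\sum_{v\in V}\sum_{t=1}^n(\mu^*-\mu_{a^v(t)})\big]$ satisfies $$\mathbb{E}[R^G(n)]\le\sum_{i:\mu_i<\mu^*}\frac{8|D|\ln n}{\Delta_i}+d,\qquad d=\Big[2m-1+\frac{2m}{4\beta-1}\Big(1+\frac{1}{(4\beta-1)\ln(1/\beta)}\Big)\Big]\sum_{j=1}^K\Delta_j.$$ -/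

import Mathlib

open MeasureTheory ProbabilityTheory

/-! Collaborative stochastic multi-armed bandits on a network, and the Follow Your Leader policy.
The arms are `Fin K`. Rounds are counted from `0`: the index `t` stands for round `t + 1`, so that
`t` is also the number of rounds that are over when the action with index `t` is chosen. -/

namespace NetworkBandit

/-- The node `v` together with its one-hop neighbours. -/
def closedNbhd {V : Type*} (G : SimpleGraph V) (v : V) : Set V := {u | u = v ∨ G.Adj v u}

/-- `D` is a dominating set: every node outside `D` is adjacent to at least one node of `D`. -/
def IsDominatingSet {V : Type*} (G : SimpleGraph V) (D : Finset V) : Prop :=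
  ∀ v, v ∉ D → ∃ u ∈ D, G.Adj u v

/-- A dominating set partition based on `D`: a partition of the nodes into `|D|` components, each
of which contains a node of `D` and a subset of its one-hop neighbours. As there are as many
components as nodes of `D`, every component contains exactly one node of `D`, and the partition is
recorded by the map that sends a node to the node of `D` in its component. -/
structure DominatingSetPartition {V : Type*} (G : SimpleGraph V) (D : Finset V) where
  /-- The node of `D` in the component of a node. -/
  leader : V → V
  leader_mem : ∀ v, leader v ∈ D
  leader_of_mem : ∀ v ∈ D, leader v = v
  adj_leader : ∀ v, v ∉ D → G.Adj (leader v) v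

/-- The leader of a node is the node itself or one of its one-hop neighbours. -/
theorem DominatingSetPartition.leader_mem_closedNbhd {V : Type*} {G : SimpleGraph V} {D : Finset V}
    (P : DominatingSetPartition G D) (v : V) : P.leader v ∈ closedNbhd G v := by
  by_cases hv : v ∈ D
  · exact Or.inl (P.leader_of_mem v hv)
  · exact Or.inr (P.adj_leader v hv).symm

/-- What user `v` has observed after `t` rounds: the actions and the rewards of itself and of its
one-hop neighbours in these rounds. -/
abbrev History {V : Type*} (G : SimpleGraph V) (K : ℕ) (v : V) (t : ℕ) : Type _ :=
  Fin t → closedNbhd G v → Fin K × ℝ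

/-- A policy of the network: after `t` rounds, user `v` chooses its next action as a (measurable)
function of its observations, and possibly of a random arm that it has drawn privately. -/
structure NetworkPolicy {V : Type*} (G : SimpleGraph V) (K : ℕ) where
  choice : (v : V) → (t : ℕ) → Fin K → History G K v t → Fin K
  measurable_choice : ∀ v t,
    Measurable (fun p : Fin K × History G K v t => choice v t p.1 p.2)

/-- The actions that the policy `Φ` produces, given the privately drawn arms `z` and the table `x`
of rewards: `x t v i` is the reward that user `v` receives in the round with index `t` if it plays
arm `i` there. -/
noncomputable def NetworkPolicy.action {V : Type*} {G : SimpleGraph V} {K : ℕ}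
    (Φ : NetworkPolicy G K) (z : V → Fin K) (x : ℕ → V → Fin K → ℝ) (t : ℕ) (v : V) : Fin K :=
  Φ.choice v t (z v) (fun s u =>
    (Φ.action z x s.1 u.1, x s.1 u.1 (Φ.action z x s.1 u.1)))
termination_by t
decreasing_by all_goals exact s.2

section Leader

variable {V : Type*} [Fintype V] {G : SimpleGraph V} {D : Finset V} {K : ℕ}

open Classical in
/-- The number of times that arm `i` was chosen in the component of the leader `v`. -/
noncomputable def sampleCount (P : DominatingSetPartition G D) (v : V) {t : ℕ}
    (h : History G K v t) (i : Fin K) : ℕ :=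
  ∑ s : Fin t, ∑ u : closedNbhd G v, if P.leader u = v ∧ (h s u).1 = i then 1 else 0

open Classical in
/-- The average of the rewards obtained from arm `i` in the component of the leader `v`. -/
noncomputable def sampleMean (P : DominatingSetPartition G D) (v : V) {t : ℕ}
    (h : History G K v t) (i : Fin K) : ℝ :=
  1 / (sampleCount P v h i : ℝ) *
    ∑ s : Fin t, ∑ u : closedNbhd G v, if P.leader u = v ∧ (h s u).1 = i then (h s u).2 else 0

/-- The upper confidence index of arm `i` for the leader `v` after `t` rounds. -/
noncomputable def ucbIndex (P : DominatingSetPartition G D) (v : V) {t : ℕ}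
    (h : History G K v t) (i : Fin K) : ℝ :=
  sampleMean P v h i + Real.sqrt (2 * Real.log t / (sampleCount P v h i : ℝ))

/-- `Φ` is a Follow Your Leader policy for the given dominating set and partition. The leaders (the
nodes of `D`) play every arm once in the first `K` rounds, and then an arm of largest index (ties
are broken in any way). A follower plays a randomly drawn arm in the first round, and from then on
the action taken by its leader in the previous round. -/
structure IsFYL (P : DominatingSetPartition G D) (Φ : NetworkPolicy G K) : Prop where
  leader_init : ∀ v ∈ D, ∀ (t : ℕ) (ht : t < K) (z : Fin K) (h : History G K v t),
    Φ.choice v t z h = ⟨t, ht⟩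
  leader_loop : ∀ v ∈ D, ∀ t : ℕ, K ≤ t → ∀ (z : Fin K) (h : History G K v t) (j : Fin K),
    ucbIndex P v h j ≤ ucbIndex P v h (Φ.choice v t z h)
  follower_init : ∀ v, v ∉ D → ∀ (z : Fin K) (h : History G K v 0), Φ.choice v 0 z h = z
  follower_loop : ∀ v, v ∉ D → ∀ (t : ℕ) (z : Fin K) (h : History G K v (t + 1)),
    Φ.choice v (t + 1) z h = (h (Fin.last t) ⟨P.leader v, P.leader_mem_closedNbhd v⟩).1

end Leader

section Regret

variable {K : ℕ}

/-- The mean reward of arm `i`. -/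
noncomputable def armMean (ν : Fin K → Measure ℝ) (i : Fin K) : ℝ := ∫ y, y ∂(ν i)

/-- The largest mean reward. -/
noncomputable def optMean (ν : Fin K → Measure ℝ) : ℝ := ⨆ i, armMean ν i

/-- The gap `Δ i` of arm `i`. -/
noncomputable def gap (ν : Fin K → Measure ℝ) (i : Fin K) : ℝ := optMean ν - armMean ν i

/-- The (pseudo-)regret of the whole network up to round `n`, the sum over all users `v` and all
rounds `t ≤ n` of the largest mean minus the mean of the arm played by `v` in round `t`. -/
noncomputable def networkRegret {V : Type*} [Fintype V] {G : SimpleGraph V}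
    (ν : Fin K → Measure ℝ) (Φ : NetworkPolicy G K) (z : V → Fin K) (x : ℕ → V → Fin K → ℝ)
    (n : ℕ) : ℝ :=
  ∑ v : V, ∑ t ∈ Finset.range n, (optMean ν - armMean ν (Φ.action z x t v))

/-- The random environment: arm `i` has reward law `ν i`; the rewards `X t v i`, for all rounds
`t`, users `v` and arms `i`, are independent, `X t v i` having law `ν i`; and the arms `Z v` drawn
privately by the users (with an arbitrary joint law) are independent of all the rewards. -/
structure IsEnvironment {V Ω : Type*} [MeasurableSpace Ω] (Pr : Measure Ω)
    (ν : Fin K → Measure ℝ) (X : ℕ → V → Fin K → Ω → ℝ) (Z : V → Ω → Fin K) : Prop where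
  measurable_reward : ∀ t v i, Measurable (X t v i)
  reward_law : ∀ t v i, Measure.map (X t v i) Pr = ν i
  indep_rewards : iIndepFun (fun p : ℕ × V × Fin K => X p.1 p.2.1 p.2.2) Pr
  measurable_draw : ∀ v, Measurable (Z v)
  indep_draws : IndepFun (fun ω v => Z v ω) (fun ω (p : ℕ × V × Fin K) => X p.1 p.2.1 p.2.2 ω) Pr

end Regret

end NetworkBandit

/-! Fix the drawn arms. Listed lexicographically by round and user, the rewards form a sequence in
which the decision whether a reward is collected depends on earlier rewards only, so that the
exponential supermartingale controls the mean of the collected rewards for each number of samples.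
Followers repeat their leader with a delay of one round, and hence the number of samples in a
component is determined by the number of plays of the leader and its last action: only `2 t` values
are possible, whatever the size of the component, and the union bound over them leaves the summable
misestimation probability `4 / t ^ 3`. For the same reason every play of the leader adds at most one
sample per member of the component. Since an arm that is sampled more than `8 log n / Δ ^ 2` times
is played only if a mean is misestimated, the number of samples exceeds this threshold by at most a
multiple of the size of the component in expectation. -/

open scoped Finset ENNReal NNReal

namespace NetworkBandit

section PredictableSampling

variable {ι κ Ω : Type*} {mΩ : MeasurableSpace Ω} {m : ι → MeasurableSpace Ω} {P : Measure Ω}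

section StrictPast

variable [Preorder κ] {τ : ι → κ}

/-- The information carried by the sources `p` whose time stamp `τ p` is smaller than `k`, where
`m p` is the information carried by the source `p`. -/
@[reducible]
def strictPast (m : ι → MeasurableSpace Ω) (τ : ι → κ) (k : κ) : MeasurableSpace Ω :=
  ⨆ p ∈ {p | τ p < k}, m p

theorem le_strictPast {p : ι} {k : κ} (hp : τ p < k) : m p ≤ strictPast m τ k :=
  le_iSup₂_of_le (f := fun p (_ : p ∈ {p | τ p < k}) => m p) p hp le_rfl

theorem strictPast_le (hm : ∀ p, m p ≤ mΩ) (k : κ) : strictPast m τ k ≤ mΩ :=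
  iSup₂_le fun p _ => hm p

theorem strictPast_mono {k l : κ} (hkl : k ≤ l) : strictPast m τ k ≤ strictPast m τ l :=
  biSup_mono fun _ hp => lt_of_lt_of_le hp hkl

theorem indep_strictPast (hm : ∀ p, m p ≤ mΩ) (hind : iIndep m P) (p : ι) :
    Indep (strictPast m τ (τ p)) (m p) P := by
  have h := indep_iSup_of_disjoint hm hind (S := {q | τ q < τ p}) (T := {p})
    (Set.disjoint_singleton_right.2 (lt_irrefl (τ p)))
  simpa only [Set.mem_singleton_iff, iSup_iSup_eq_left] using h

end StrictPast

variable [LinearOrder κ] {τ : ι → κ} {T : Finset ι} {S : Ω → Finset ι}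

/-- `S` is a random finite set of sources, contained in `T`, such that the decision whether a source
belongs to `S` depends only on the independent sources with an earlier time stamp. -/
structure IsPredictableSample (m : ι → MeasurableSpace Ω) (τ : ι → κ) (T : Finset ι)
    (S : Ω → Finset ι) (P : Measure Ω) : Prop where
  le : ∀ p, m p ≤ mΩ
  iIndep : iIndep m P
  injOn : Set.InjOn τ T
  subset : ∀ ω, S ω ⊆ T
  measurableSet_mem : ∀ p ∈ T, MeasurableSet[strictPast m τ (τ p)] {ω | p ∈ S ω}

theorem lintegral_mul_ite_le {m₁ m₂ : MeasurableSpace Ω} (h₁ : m₁ ≤ mΩ) (h₂ : m₂ ≤ mΩ)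
    (hind : Indep m₁ m₂ P) {M Y : Ω → ℝ≥0∞} (hM : Measurable[m₁] M) (hY : Measurable[m₂] Y)
    {B : Set Ω} [DecidablePred (· ∈ B)] (hB : MeasurableSet[m₁] B) (hY1 : ∫⁻ ω, Y ω ∂P ≤ 1) :
    ∫⁻ ω, M ω * (if ω ∈ B then Y ω else 1) ∂P ≤ ∫⁻ ω, M ω ∂P := by
  have hMB : Measurable[m₁] (B.indicator M) := hM.indicator hB
  calc ∫⁻ ω, M ω * (if ω ∈ B then Y ω else 1) ∂P
      = ∫⁻ ω, B.indicator M ω * Y ω + Bᶜ.indicator M ω ∂P := by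
        refine lintegral_congr fun ω => ?_
        by_cases hω : ω ∈ B <;> simp [hω]
    _ = (∫⁻ ω, B.indicator M ω ∂P) * (∫⁻ ω, Y ω ∂P) + ∫⁻ ω, Bᶜ.indicator M ω ∂P := by
        rw [lintegral_add_right _ ((hM.indicator hB.compl).mono h₁ le_rfl),
          lintegral_mul_eq_lintegral_mul_lintegral_of_independent_measurableSpace h₁ h₂ hind hMB hY]
    _ ≤ ∫⁻ ω, B.indicator M ω ∂P + ∫⁻ ω, Bᶜ.indicator M ω ∂P := by
        gcongr
        exact mul_le_of_le_one_right' hY1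
    _ = ∫⁻ ω, M ω ∂P := by
        rw [lintegral_indicator (h₁ _ hB), lintegral_indicator (h₁ _ hB.compl),
          lintegral_add_compl _ (h₁ _ hB)]

theorem measureReal_ge_le_exp_neg {f : Ω → ℝ} (hf : Measurable f)
    (hint : ∫⁻ ω, ENNReal.ofReal (Real.exp (f ω)) ∂P ≤ 1) (a : ℝ) :
    P.real {ω | a ≤ f ω} ≤ Real.exp (-a) := by
  have hmarkov := (mul_meas_ge_le_lintegral (μ := P) hf.exp.ennreal_ofReal
    (ENNReal.ofReal (Real.exp a))).trans hint
  simp only [ENNReal.ofReal_le_ofReal_iff (Real.exp_nonneg _), Real.exp_le_exp] at hmarkov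
  refine ENNReal.toReal_le_of_le_ofReal (Real.exp_nonneg _) ?_
  rw [Real.exp_neg, ENNReal.ofReal_inv_of_pos (Real.exp_pos a)]
  exact ENNReal.le_inv_iff_mul_le.2 (by rwa [mul_comm])

namespace IsPredictableSample

theorem measurable_sum (h : IsPredictableSample m τ T S P) {β : Type*} [AddCommMonoid β]
    [MeasurableSpace β] [MeasurableAdd₂ β] {f : ι → Ω → β} (hf : ∀ p, Measurable (f p)) :
    Measurable fun ω => ∑ p ∈ S ω, f p ω := by
  classical
  have heq : (fun ω => ∑ p ∈ S ω, f p ω) = fun ω => ∑ p ∈ T, if p ∈ S ω then f p ω else 0 := by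
    funext ω
    rw [Finset.sum_ite_mem, Finset.inter_eq_right.2 (h.subset ω)]
  rw [heq]
  exact Finset.measurable_sum _ fun p hp => Measurable.ite
    (strictPast_le h.le _ _ (h.measurableSet_mem p hp)) (hf p) measurable_const

theorem lintegral_prod_le_one (h : IsPredictableSample m τ T S P) {Y : ι → Ω → ℝ≥0∞}
    (hY : ∀ p, Measurable[m p] (Y p)) (hY1 : ∀ p, ∫⁻ ω, Y p ω ∂P ≤ 1) :
    ∫⁻ ω, ∏ p ∈ S ω, Y p ω ∂P ≤ 1 := by
  classical
  have : IsProbabilityMeasure P := h.iIndep.isProbabilityMeasure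
  suffices hR : ∀ R ⊆ T, ∫⁻ ω, ∏ p ∈ R, (if p ∈ S ω then Y p ω else 1) ∂P ≤ 1 by
    simpa only [Finset.prod_ite_mem, Finset.inter_eq_right.2 (h.subset _)] using
      hR T subset_rfl
  intro R
  induction R using Finset.induction_on_max_value τ with
  | empty => simp
  | insert a R haR hmax ih =>
    intro hRT
    obtain ⟨haT, hRT⟩ := Finset.insert_subset_iff.1 hRT
    have hlt : ∀ p ∈ R, τ p < τ a := fun p hp => (hmax p hp).lt_of_ne fun he =>
      haR (h.injOn (hRT hp) haT he ▸ hp)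
    have hpast : Measurable[strictPast m τ (τ a)]
        fun ω => ∏ p ∈ R, if p ∈ S ω then Y p ω else 1 :=
      Finset.measurable_prod _ fun p hp => Measurable.ite
        (strictPast_mono (hmax p hp) _ (h.measurableSet_mem p (hRT hp)))
        ((hY p).mono (le_strictPast (hlt p hp)) le_rfl) measurable_const
    simp_rw [Finset.prod_insert haR, mul_comm (ite _ _ _)]
    exact (lintegral_mul_ite_le (B := {ω | a ∈ S ω}) (strictPast_le h.le _) (h.le a)
      (indep_strictPast h.le h.iIndep a) hpast (hY a) (h.measurableSet_mem a haT) (hY1 a)).trans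
      (ih hRT)

variable {ξ : ι → Ω → ℝ} {c : ℝ≥0}

theorem lintegral_exp_le_one (h : IsPredictableSample m τ T S P)
    (hξ : ∀ p, Measurable[m p] (ξ p)) (hsub : ∀ p, HasSubgaussianMGF (ξ p) c P) (l : ℝ) :
    ∫⁻ ω, ENNReal.ofReal (Real.exp (l * ∑ p ∈ S ω, ξ p ω - #(S ω) * (c * l ^ 2 / 2))) ∂P ≤ 1 := by
  have hexp : ∀ ω, ENNReal.ofReal
      (Real.exp (l * ∑ p ∈ S ω, ξ p ω - #(S ω) * (c * l ^ 2 / 2))) =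
      ∏ p ∈ S ω, ENNReal.ofReal (Real.exp (l * ξ p ω - c * l ^ 2 / 2)) := fun ω => by
    rw [← ENNReal.ofReal_prod_of_nonneg fun _ _ => Real.exp_nonneg _, ← Real.exp_sum,
      Finset.sum_sub_distrib, Finset.sum_const, nsmul_eq_mul, Finset.mul_sum]
  simp_rw [hexp]
  refine h.lintegral_prod_le_one (fun p => ?_) fun p => ?_
  · exact (((hξ p).const_mul l).sub_const _).exp.ennreal_ofReal
  · simp_rw [Real.exp_sub, div_eq_mul_inv]
    rw [← ofReal_integral_eq_lintegral_ofReal (((hsub p).integrable_exp_mul l).mul_const _)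
      (.of_forall fun ω => by positivity), integral_mul_const, ← div_eq_mul_inv]
    exact ENNReal.ofReal_le_one.2 ((div_le_one (Real.exp_pos _)).2 ((hsub p).mgf_le l))

theorem measurable_card (h : IsPredictableSample m τ T S P) : Measurable fun ω => #(S ω) := by
  simpa only [Finset.card_eq_sum_ones] using h.measurable_sum fun _ => measurable_const (a := 1)

theorem measureReal_card_eq_and_le_sum (h : IsPredictableSample m τ T S P)
    (hξ : ∀ p, Measurable[m p] (ξ p)) (hsub : ∀ p, HasSubgaussianMGF (ξ p) c P) (k : ℕ)
    {ε : ℝ} (hε : 0 ≤ ε) :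
    P.real {ω | #(S ω) = k ∧ ε ≤ ∑ p ∈ S ω, ξ p ω} ≤ Real.exp (-(ε ^ 2 / (2 * c * k))) := by
  have : IsProbabilityMeasure P := h.iIndep.isProbabilityMeasure
  set l : ℝ := ε / (c * k) with hl
  have hexponent : l * ε - k * (c * l ^ 2 / 2) = ε ^ 2 / (2 * c * k) := by
    rcases eq_or_ne ((c : ℝ) * k) 0 with h0 | h0
    · simp [hl, h0, mul_assoc]
    · obtain ⟨hc, hk⟩ := mul_ne_zero_iff.1 h0
      rw [hl]
      field
  have hsum : Measurable fun ω => ∑ p ∈ S ω, ξ p ω :=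
    h.measurable_sum fun p => (hξ p).mono (h.le p) le_rfl
  have hcard : Measurable fun ω => (#(S ω) : ℝ) := measurable_from_top.comp h.measurable_card
  refine (measureReal_mono ?_).trans <| measureReal_ge_le_exp_neg
    ((hsum.const_mul l).sub (hcard.mul_const (c * l ^ 2 / 2))) (h.lintegral_exp_le_one hξ hsub l) _
  rintro ω ⟨hk, hω⟩
  have : 0 ≤ l := by positivity
  simp only [Set.mem_ofPred_eq, Pi.sub_apply, hk, ← hexponent]
  gcongr

theorem measureReal_card_eq_and_le_abs_sum (h : IsPredictableSample m τ T S P)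
    (hξ : ∀ p, Measurable[m p] (ξ p)) (hsub : ∀ p, HasSubgaussianMGF (ξ p) c P) (k : ℕ)
    {ε : ℝ} (hε : 0 ≤ ε) :
    P.real {ω | #(S ω) = k ∧ ε ≤ |∑ p ∈ S ω, ξ p ω|} ≤ 2 * Real.exp (-(ε ^ 2 / (2 * c * k))) := by
  have : IsProbabilityMeasure P := h.iIndep.isProbabilityMeasure
  have hneg := h.measureReal_card_eq_and_le_sum (ξ := fun p => -ξ p) (fun p => (hξ p).neg)
    (fun p => (hsub p).neg) k hε
  have hpos := h.measureReal_card_eq_and_le_sum hξ hsub k hε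
  calc _ ≤ _ := measureReal_mono (s₂ := {ω | #(S ω) = k ∧ ε ≤ ∑ p ∈ S ω, ξ p ω} ∪
        {ω | #(S ω) = k ∧ ε ≤ ∑ p ∈ S ω, (-ξ p) ω}) fun ω hω => by
          simpa [Finset.sum_neg_distrib, ← and_or_left, le_abs] using hω
    _ ≤ _ := measureReal_union_le _ _
    _ ≤ _ := by rw [two_mul]; exact add_le_add hpos hneg

/-- A union bound over the possible sample sizes turns the Chernoff bound for a fixed sample size
into a bound for the random one. -/
theorem measureReal_sqrt_le_abs_mean (h : IsPredictableSample m τ T S P)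
    (hξ : ∀ p, Measurable[m p] (ξ p)) (hsub : ∀ p, HasSubgaussianMGF (ξ p) c P) (hc : c ≠ 0)
    {R : Finset ℕ} (hS : ∀ ω, (S ω).Nonempty) (hR : ∀ ω, #(S ω) ∈ R) {L : ℝ} (hL : 0 ≤ L) :
    P.real {ω | √(2 * c * L / #(S ω)) ≤ |(∑ p ∈ S ω, ξ p ω) / #(S ω)|} ≤
      #R * (2 * Real.exp (-L)) := by
  have : IsProbabilityMeasure P := h.iIndep.isProbabilityMeasure
  have hsubset : {ω | √(2 * c * L / #(S ω)) ≤ |(∑ p ∈ S ω, ξ p ω) / #(S ω)|} ⊆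
      ⋃ k ∈ R.filter (0 < ·),
        {ω | #(S ω) = k ∧ √(2 * c * k * L) ≤ |∑ p ∈ S ω, ξ p ω|} := fun ω hω => by
    have hk : (0 : ℝ) < #(S ω) := by exact_mod_cast (hS ω).card_pos
    refine Set.mem_biUnion (x := #(S ω)) (by simp [hR, hS]) ⟨rfl, ?_⟩
    rw [Set.mem_ofPred_eq, abs_div, abs_of_pos hk, le_div_iff₀ hk] at hω
    refine le_of_eq_of_le ?_ hω
    rw [Real.sqrt_eq_iff_mul_self_eq (by positivity) (by positivity), mul_mul_mul_comm,
      Real.mul_self_sqrt (by positivity)]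
    field
  calc _ ≤ P.real (⋃ k ∈ R.filter (0 < ·),
        {ω | #(S ω) = k ∧ √(2 * c * k * L) ≤ |∑ p ∈ S ω, ξ p ω|}) :=
      measureReal_mono hsubset (measure_ne_top _ _)
    _ ≤ ∑ k ∈ R.filter (0 < ·),
        P.real {ω | #(S ω) = k ∧ √(2 * c * k * L) ≤ |∑ p ∈ S ω, ξ p ω|} :=
      measureReal_biUnion_finset_le _ _
    _ ≤ ∑ k ∈ R.filter (0 < ·), 2 * Real.exp (-L) := by
      refine Finset.sum_le_sum fun k hk => ?_
      have hk : (k : ℝ) ≠ 0 := by simpa using (Finset.mem_filter.1 hk).2.ne'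
      refine (h.measureReal_card_eq_and_le_abs_sum hξ hsub k (Real.sqrt_nonneg _)).trans_eq ?_
      rw [Real.sq_sqrt (by positivity), mul_div_cancel_left₀]
      positivity
    _ ≤ #R * (2 * Real.exp (-L)) := by
      rw [Finset.sum_const, nsmul_eq_mul]
      gcongr
      exact Finset.filter_subset _ _

end IsPredictableSample

end PredictableSampling

section Expectation

variable {Ω : Type*} {mΩ : MeasurableSpace Ω} {P : Measure Ω}

theorem integral_comp_le_of_indepFun {α β : Type*} [MeasurableSpace α] [MeasurableSpace β]
    [IsProbabilityMeasure P] {Z : Ω → α} {X : Ω → β} (hZ : Measurable Z) (hX : Measurable X)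
    (hind : IndepFun Z X P) {F : α → β → ℝ} (hF : Measurable (Function.uncurry F))
    (hint : Integrable (fun ω => F (Z ω) (X ω)) P) {B : ℝ} (hB : ∀ z, ∫ ω, F z (X ω) ∂P ≤ B) :
    ∫ ω, F (Z ω) (X ω) ∂P ≤ B := by
  have := Measure.isProbabilityMeasure_map (μ := P) hZ.aemeasurable
  have hZX : AEMeasurable (fun ω => (Z ω, X ω)) P := (hZ.prodMk hX).aemeasurable
  have hprod := (indepFun_iff_map_prod_eq_prod_map_map hZ.aemeasurable hX.aemeasurable).1 hind
  have hFint : Integrable (Function.uncurry F) ((P.map Z).prod (P.map X)) := by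
    rw [← hprod]
    exact (integrable_map_measure hF.aestronglyMeasurable hZX).2 hint
  calc ∫ ω, F (Z ω) (X ω) ∂P
      = ∫ q, Function.uncurry F q ∂((P.map Z).prod (P.map X)) := by
        rw [← hprod, integral_map hZX hF.aestronglyMeasurable]
        rfl
    _ = ∫ z, ∫ x, F z x ∂(P.map X) ∂(P.map Z) := integral_prod _ hFint
    _ ≤ ∫ _, B ∂(P.map Z) := by
        refine integral_mono hFint.integral_prod_left (integrable_const _) fun z => ?_
        exact (integral_map hX.aemeasurable
          hF.of_uncurry_left.aestronglyMeasurable).trans_le (hB z)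
    _ = B := by simp

theorem count_mem_eq_sum_indicator (E : ℕ → Set Ω) (n : ℕ) (ω : Ω)
    [DecidablePred fun t => ω ∈ E t] :
    (Nat.count (fun t => ω ∈ E t) n : ℝ) = ∑ t ∈ Finset.range n, (E t).indicator 1 ω := by
  simp [Nat.count_eq_card_filter_range, Set.indicator_apply]

variable [IsFiniteMeasure P] {E : ℕ → Set Ω} [∀ ω, DecidablePred fun t => ω ∈ E t]

theorem integrable_count_mem (hE : ∀ t, MeasurableSet (E t)) (n : ℕ) :
    Integrable (fun ω => (Nat.count (fun t => ω ∈ E t) n : ℝ)) P := by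
  simp_rw [count_mem_eq_sum_indicator]
  exact integrable_finsetSum _ fun t _ => (integrable_const 1).indicator (hE t)

theorem integral_count_mem (hE : ∀ t, MeasurableSet (E t)) (n : ℕ) :
    ∫ ω, (Nat.count (fun t => ω ∈ E t) n : ℝ) ∂P = ∑ t ∈ Finset.range n, P.real (E t) := by
  simp_rw [count_mem_eq_sum_indicator]
  rw [integral_finsetSum _ fun t _ => (integrable_const 1).indicator (hE t)]
  exact Finset.sum_congr rfl fun t _ => integral_indicator_one (hE t)

end Expectation

section Counting

theorem le_add_mul_count {R : Type*} [Semiring R] [PartialOrder R] [IsOrderedRing R] {f : ℕ → R}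
    {b c : R} (hc : 0 ≤ c) {p : ℕ → Prop} [DecidablePred p] {n : ℕ} (h0 : f 0 ≤ b)
    (hstep : ∀ t < n, f (t + 1) ≤ f t ∨ f (t + 1) ≤ b ∨ p t ∧ f (t + 1) ≤ f t + c) :
    f n ≤ b + c * Nat.count p n := by
  induction n with
  | zero => simpa using h0
  | succ n ih =>
    have hn := ih fun t ht => hstep t (ht.trans n.lt_succ_self)
    have hmono : b + c * Nat.count p n ≤ b + c * Nat.count p (n + 1) := by
      gcongr
      exact n.le_succ
    rcases hstep n n.lt_succ_self with h | h | ⟨hp, h⟩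
    · exact h.trans (hn.trans hmono)
    · exact h.trans (le_add_of_nonneg_right (mul_nonneg hc (Nat.cast_nonneg _)))
    · rw [Nat.count_succ, if_pos hp, Nat.cast_succ, mul_add, mul_one, ← add_assoc]
      exact h.trans (add_le_add_left hn c)

theorem sum_Ico_inv_cube_le (n : ℕ) : ∑ t ∈ Finset.Ico 2 n, 1 / (t : ℝ) ^ 3 ≤ 1 / 4 := by
  rcases le_or_gt n 2 with hn | hn
  · simp [Finset.Ico_eq_empty_of_le hn]
  have htelescope : ∀ k : ℕ, 2 ≤ k →
      ∑ t ∈ Finset.Ico 2 k, 1 / (t : ℝ) ^ 3 ≤ 1 / 4 - 1 / (2 * (((k : ℝ) - 1) * k)) := by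
    intro k hk
    induction k, hk using Nat.le_induction with
    | base => norm_num
    | succ k hk ih =>
      have hk' : (2 : ℝ) ≤ k := by exact_mod_cast hk
      have hk0 : 0 < (k : ℝ) - 1 := by linarith
      have hcube : 1 / (k : ℝ) ^ 3 ≤ 1 / ((k - 1) * k * (k + 1)) :=
        one_div_le_one_div_of_le (by positivity) (by nlinarith)
      have hsplit : 1 / (((k : ℝ) - 1) * k * (k + 1)) =
          1 / (2 * ((k - 1) * k)) - 1 / (2 * (k * (k + 1))) := by
        field
      rw [Finset.sum_Ico_succ_top hk, Nat.cast_add_one, add_sub_cancel_right]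
      linarith
  have hn' : (2 : ℝ) < n := by exact_mod_cast hn
  refine (htelescope n hn.le).trans (sub_le_self _ (one_div_nonneg.2 ?_))
  nlinarith

end Counting

section Samples

variable {V α : Type*} [DecidableEq α]

/-- The number of times that user `u` plays arm `i` before round `t`, when `A` is the table of
actions. -/
def playCount (A : ℕ → V → α) (u : V) (i : α) (t : ℕ) : ℕ := Nat.count (fun s => A s u = i) t

/-- The triples `(s, u, i)` such that the user `u`, who belongs to `C`, plays arm `i` in round `s`,
before round `t`. They index the rewards from arm `i` that the users in `C` have collected. -/
def samples (A : ℕ → V → α) (C : Finset V) (i : α) (t : ℕ) : Finset (ℕ × V × α) :=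
  {p ∈ Finset.range t ×ˢ C ×ˢ {i} | A p.1 p.2.1 = i}

variable (A : ℕ → V → α) (C : Finset V) (i : α) (t : ℕ)

theorem sum_samples {M : Type*} [AddCommMonoid M] (f : ℕ × V × α → M) :
    ∑ p ∈ samples A C i t, f p =
      ∑ s ∈ Finset.range t, ∑ u ∈ C, if A s u = i then f (s, u, i) else 0 := by
  simp only [samples, Finset.sum_filter, Finset.sum_product, Finset.sum_singleton]

theorem card_samples : #(samples A C i t) = ∑ u ∈ C, playCount A u i t := by
  rw [Finset.card_eq_sum_ones, sum_samples, Finset.sum_comm]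
  simp only [playCount, Nat.count_eq_card_filter_range, Finset.card_filter]

end Samples

section Components

variable {V : Type*} [Fintype V] {G : SimpleGraph V} {D : Finset V}
  (P : DominatingSetPartition G D)

namespace DominatingSetPartition

open Classical in
/-- The component of the node `v` of `D`. -/
noncomputable def component (v : V) : Finset V := {u | P.leader u = v}

open Classical in
/-- The component of `v` without `v`. -/
noncomputable def followers (v : V) : Finset V := (P.component v).erase v

variable {P}

theorem mem_component {u v : V} : u ∈ P.component v ↔ P.leader u = v := by simp [component]

theorem sum_component {M : Type*} [AddCommMonoid M] {v : V} (hv : v ∈ D) (f : V → M) :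
    ∑ u ∈ P.component v, f u = f v + ∑ u ∈ P.followers v, f u := by
  classical
  rw [followers, Finset.add_sum_erase _ _ (mem_component.2 (P.leader_of_mem v hv))]

theorem card_component {v : V} (hv : v ∈ D) : #(P.component v) = #(P.followers v) + 1 := by
  simp only [Finset.card_eq_sum_ones, sum_component hv, add_comm]

theorem leader_of_mem_followers {u v : V} (hu : u ∈ P.followers v) : P.leader u = v := by
  classical
  exact mem_component.1 (Finset.mem_of_mem_erase hu)

theorem notMem_of_mem_followers {u v : V} (hu : u ∈ P.followers v) : u ∉ D := by
  classical
  exact fun h => Finset.ne_of_mem_erase hu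
    ((P.leader_of_mem u h).symm.trans (leader_of_mem_followers hu))

variable (P)

theorem sum_univ {M : Type*} [AddCommMonoid M] (f : V → M) :
    ∑ u, f u = ∑ v ∈ D, ∑ u ∈ P.component v, f u := by
  classical
  exact (Finset.sum_fiberwise_of_maps_to (fun u _ => P.leader_mem u) f).symm

theorem sum_card_component : ∑ v ∈ D, #(P.component v) = Fintype.card V := by
  simpa using (P.sum_univ fun _ => (1 : ℕ)).symm

theorem sum_closedNbhd {M : Type*} [AddCommMonoid M] {v : V} [Fintype (closedNbhd G v)]
    [DecidablePred fun u => P.leader u = v] (f : V → M) :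
    (∑ u : closedNbhd G v, if P.leader u = v then f u else 0) = ∑ u ∈ P.component v, f u := by
  classical
  have himage : (Finset.univ.filter fun u : closedNbhd G v => P.leader u = v).map
      (Function.Embedding.subtype _) = P.component v := by
    ext u
    have hu : P.leader u = v → u ∈ closedNbhd G v := fun h => by
      by_cases huD : u ∈ D
      · exact Or.inl ((P.leader_of_mem u huD).symm.trans h)
      · exact Or.inr (h ▸ P.adj_leader u huD)
    simpa [mem_component] using hu
  rw [← himage, Finset.sum_map, Finset.sum_filter]
  rfl

end DominatingSetPartition

end Components

section History

variable {V : Type*} {G : SimpleGraph V} {K : ℕ}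

/-- The observations of user `v` after `t` rounds, when the policy `Φ` is run with the drawn arms
`z` on the table `x` of rewards. -/
noncomputable def NetworkPolicy.history (Φ : NetworkPolicy G K) (z : V → Fin K)
    (x : ℕ → V → Fin K → ℝ) (t : ℕ) (v : V) : History G K v t :=
  fun s u => (Φ.action z x s u, x s u (Φ.action z x s u))

theorem NetworkPolicy.action_eq_choice (Φ : NetworkPolicy G K) (z : V → Fin K)
    (x : ℕ → V → Fin K → ℝ) (t : ℕ) (v : V) :
    Φ.action z x t v = Φ.choice v t (z v) (Φ.history z x t v) := by
  rw [NetworkPolicy.action]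
  rfl

variable [Fintype V] {D : Finset V} (P : DominatingSetPartition G D) (Φ : NetworkPolicy G K)
  (z : V → Fin K) (x : ℕ → V → Fin K → ℝ) (v : V) (t : ℕ) (i : Fin K)

open Classical in
theorem sum_history_eq_sum_samples {M : Type*} [AddCommMonoid M] (f : Fin K × ℝ → M) :
    (∑ s : Fin t, ∑ u : closedNbhd G v,
      if P.leader u = v ∧ (Φ.history z x t v s u).1 = i then f (Φ.history z x t v s u) else 0) =
      ∑ p ∈ samples (Φ.action z x) (P.component v) i t, f (i, x p.1 p.2.1 p.2.2) := by
  rw [sum_samples, Finset.sum_range]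
  refine Finset.sum_congr rfl fun s _ => ?_
  rw [← P.sum_closedNbhd]
  refine Finset.sum_congr rfl fun u _ => ?_
  by_cases hu : P.leader u = v <;> by_cases hi : Φ.action z x s u = i <;>
    simp [NetworkPolicy.history, hu, hi]

theorem sampleCount_history : sampleCount P v (Φ.history z x t v) i =
    #(samples (Φ.action z x) (P.component v) i t) := by
  rw [Finset.card_eq_sum_ones]
  exact sum_history_eq_sum_samples P Φ z x v t i fun _ => 1

theorem sampleMean_history : sampleMean P v (Φ.history z x t v) i =
    (∑ p ∈ samples (Φ.action z x) (P.component v) i t, x p.1 p.2.1 p.2.2) /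
      #(samples (Φ.action z x) (P.component v) i t) := by
  rw [sampleMean, sampleCount_history, one_div_mul_eq_div]
  exact congrArg (· / _) (sum_history_eq_sum_samples P Φ z x v t i Prod.snd)

end History

section UpperConfidence

variable {V : Type*} [Fintype V] {G : SimpleGraph V} {D : Finset V} {K : ℕ}

/-- After `t` rounds, the average of the rewards from arm `i` in the component of `v` differs from
`μ` by at least the width of the confidence interval. -/
def IsMisestimated (P : DominatingSetPartition G D) (v : V) {t : ℕ} (h : History G K v t)
    (i : Fin K) (μ : ℝ) : Prop :=
  √(2 * Real.log t / sampleCount P v h i) ≤ |sampleMean P v h i - μ|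

theorem sampleCount_lt_of_ucbIndex_le {P : DominatingSetPartition G D} {v : V} {t : ℕ}
    {h : History G K v t} {i j : Fin K} {μi μj : ℝ} (hucb : ucbIndex P v h j ≤ ucbIndex P v h i)
    (hμ : μi < μj) (hi : ¬ IsMisestimated P v h i μi) (hj : ¬ IsMisestimated P v h j μj) :
    (sampleCount P v h i : ℝ) < 8 * Real.log t / (μj - μi) ^ 2 := by
  rw [IsMisestimated, not_le] at hi hj
  set w := √(2 * Real.log t / sampleCount P v h i)
  have hwidth : μj - μi < 2 * w := by
    have hi := (abs_lt.1 hi).2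
    have hj := (abs_lt.1 hj).1
    unfold ucbIndex at hucb
    linarith
  have hw : 0 < w := by linarith
  have hcount : (0 : ℝ) < sampleCount P v h i := by
    refine Nat.cast_pos.2 (Nat.pos_of_ne_zero fun h0 => hw.ne' ?_)
    simp [w, h0]
  rw [lt_div_iff₀ (by nlinarith), ← lt_div_iff₀' hcount]
  calc (μj - μi) ^ 2 < (2 * w) ^ 2 := by gcongr
    _ = 8 * Real.log t / sampleCount P v h i := by
      rw [mul_pow, Real.sq_sqrt (Real.sqrt_pos.1 hw).le]
      ring

end UpperConfidence

section FollowYourLeader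

variable {V : Type*} [Fintype V] {G : SimpleGraph V} {D : Finset V} {K : ℕ}

/-- The number of followers of `v` that have drawn arm `i`. -/
noncomputable def DominatingSetPartition.drawCount (P : DominatingSetPartition G D)
    (z : V → Fin K) (v : V) (i : Fin K) : ℕ :=
  #{u ∈ P.followers v | z u = i}

variable {P : DominatingSetPartition G D} {Φ : NetworkPolicy G K} (z : V → Fin K)
  (x : ℕ → V → Fin K → ℝ) {v : V} (i : Fin K) (t : ℕ)

theorem drawCount_lt_card_component (hv : v ∈ D) : P.drawCount z v i < #(P.component v) := by
  rw [DominatingSetPartition.card_component hv, Nat.lt_succ_iff]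
  exact Finset.card_filter_le _ _

namespace IsFYL

variable (hΦ : IsFYL P Φ) {t}
include hΦ

theorem action_leader_of_lt (hv : v ∈ D) (ht : t < K) : Φ.action z x t v = ⟨t, ht⟩ := by
  rw [Φ.action_eq_choice]
  exact hΦ.leader_init v hv t ht _ _

theorem ucbIndex_le_action (hv : v ∈ D) (ht : K ≤ t) (j : Fin K) :
    ucbIndex P v (Φ.history z x t v) j ≤
      ucbIndex P v (Φ.history z x t v) (Φ.action z x t v) := by
  rw [Φ.action_eq_choice]
  exact hΦ.leader_loop v hv t ht _ _ j

theorem action_zero_of_notMem (hv : v ∉ D) : Φ.action z x 0 v = z v := by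
  rw [Φ.action_eq_choice]
  exact hΦ.follower_init v hv _ _

variable (t) in
theorem action_succ_of_notMem (hv : v ∉ D) :
    Φ.action z x (t + 1) v = Φ.action z x t (P.leader v) := by
  rw [Φ.action_eq_choice]
  exact hΦ.follower_loop v hv t _ _

theorem playCount_leader_eq_zero (hv : v ∈ D) (ht : t ≤ i) :
    playCount (Φ.action z x) v i t = 0 := by
  rw [playCount, Nat.count_eq_card_filter_range, Finset.card_eq_zero, Finset.filter_eq_empty_iff]
  intro s hs hplay
  have hsi : s < i := (Finset.mem_range.1 hs).trans_le ht
  rw [hΦ.action_leader_of_lt z x hv (hsi.trans i.2)] at hplay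
  exact hsi.ne (congrArg Fin.val hplay)

theorem samples_nonempty (hv : v ∈ D) (ht : K ≤ t) :
    (samples (Φ.action z x) (P.component v) i t).Nonempty :=
  ⟨(i, v, i), by
    simp [samples, i.2.trans_le ht, DominatingSetPartition.mem_component, P.leader_of_mem v hv,
      hΦ.action_leader_of_lt z x hv i.2]⟩

variable (t) in
theorem playCount_follower_succ {u : V} (hu : u ∈ P.followers v) :
    playCount (Φ.action z x) u i (t + 1) =
      playCount (Φ.action z x) v i t + if z u = i then 1 else 0 := by
  have huD := DominatingSetPartition.notMem_of_mem_followers hu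
  simp only [playCount, Nat.count_succ', hΦ.action_zero_of_notMem z x huD,
    hΦ.action_succ_of_notMem z x _ huD, DominatingSetPartition.leader_of_mem_followers hu]

variable (t) in
theorem card_samples_succ (hv : v ∈ D) :
    #(samples (Φ.action z x) (P.component v) i (t + 1)) =
      playCount (Φ.action z x) v i (t + 1) +
        #(P.followers v) * playCount (Φ.action z x) v i t + P.drawCount z v i := by
  rw [card_samples, DominatingSetPartition.sum_component hv,
    Finset.sum_congr rfl fun u hu => hΦ.playCount_follower_succ z x i t hu,
    Finset.sum_add_distrib, Finset.sum_const, smul_eq_mul, ← Finset.card_filter, add_assoc]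
  rfl

variable (t) in
theorem card_samples_le (hv : v ∈ D) :
    #(samples (Φ.action z x) (P.component v) i t) ≤
      P.drawCount z v i + #(P.component v) * playCount (Φ.action z x) v i t := by
  cases t with
  | zero => simp [samples]
  | succ t =>
    have hmono : playCount (Φ.action z x) v i t ≤ playCount (Φ.action z x) v i (t + 1) :=
      Nat.count_monotone _ t.le_succ
    rw [hΦ.card_samples_succ z x i t hv, DominatingSetPartition.card_component hv]
    linarith [Nat.mul_le_mul_left #(P.followers v) hmono]

variable (t) in
theorem lt_card_samples_add (hv : v ∈ D) :
    P.drawCount z v i + #(P.component v) * playCount (Φ.action z x) v i t <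
      #(samples (Φ.action z x) (P.component v) i t) + #(P.component v) := by
  cases t with
  | zero => simpa [samples, playCount] using drawCount_lt_card_component z i hv
  | succ t =>
    have hstep : playCount (Φ.action z x) v i (t + 1) ≤ playCount (Φ.action z x) v i t + 1 := by
      rw [playCount, Nat.count_succ]
      split_ifs <;> simp [playCount]
    rw [hΦ.card_samples_succ z x i t hv, DominatingSetPartition.card_component hv]
    linarith [Nat.mul_le_mul_left #(P.followers v) hstep]

/-- As the draws are fixed, the number of samples is determined by the numbers of plays of the
leader alone, so that it takes at most `2 t` values, however large the component is. -/
theorem exists_card_samples_mem (hv : v ∈ D) (ht : t ≠ 0) :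
    ∃ R : Finset ℕ, #R ≤ 2 * t ∧
      ∀ x, #(samples (Φ.action z x) (P.component v) i t) ∈ R := by
  obtain ⟨t, rfl⟩ := Nat.exists_eq_succ_of_ne_zero ht
  refine ⟨(Finset.range 2 ×ˢ Finset.range (t + 1)).image fun q =>
    q.2 + q.1 + #(P.followers v) * q.2 + P.drawCount z v i,
    Finset.card_image_le.trans (by simp), fun x => ?_⟩
  refine Finset.mem_image.2 ⟨(if Φ.action z x t v = i then 1 else 0,
    playCount (Φ.action z x) v i t), ?_, ?_⟩
  · rw [Finset.mem_product, Finset.mem_range, Finset.mem_range]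
    exact ⟨by split_ifs <;> simp, Nat.lt_succ_of_le (Nat.count_le _)⟩
  · rw [hΦ.card_samples_succ z x i t hv, playCount, playCount, Nat.count_succ]

theorem drawCount_add_mul_playCount_lt (hv : v ∈ D) {i j : Fin K} {μi μj : ℝ} (hμ : μi < μj)
    (ht : K ≤ t) (hplay : Φ.action z x t v = i)
    (hi : ¬ IsMisestimated P v (Φ.history z x t v) i μi)
    (hj : ¬ IsMisestimated P v (Φ.history z x t v) j μj) :
    (P.drawCount z v i + #(P.component v) * playCount (Φ.action z x) v i t + 1 : ℝ) <
      8 * Real.log t / (μj - μi) ^ 2 + #(P.component v) := by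
  have hfew := sampleCount_lt_of_ucbIndex_le (hplay ▸ hΦ.ucbIndex_le_action z x hv ht j) hμ hi hj
  rw [sampleCount_history] at hfew
  have hlt : (P.drawCount z v i : ℝ) + #(P.component v) * playCount (Φ.action z x) v i t + 1 ≤
      #(samples (Φ.action z x) (P.component v) i t) + #(P.component v) := by
    exact_mod_cast hΦ.lt_card_samples_add z x i t hv
  linarith

open Classical in
/-- A play of arm `i` by the leader of a well-sampled component reveals a misestimated mean, and
every play of the leader adds at most one sample per member of the component. -/
theorem card_samples_le_add_count (hv : v ∈ D) {j : Fin K} {μi μj : ℝ} (hμ : μi < μj) (n : ℕ) :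
    (#(samples (Φ.action z x) (P.component v) i n) : ℝ) ≤
      (8 * Real.log n / (μj - μi) ^ 2 + (2 * #(P.component v) - 1)) + #(P.component v) *
        Nat.count (fun t => K ≤ t ∧ (IsMisestimated P v (Φ.history z x t v) i μi ∨
          IsMisestimated P v (Φ.history z x t v) j μj)) n := by
  set A := Φ.action z x
  have hlog : 0 ≤ 8 * Real.log n / (μj - μi) ^ 2 :=
    div_nonneg (mul_nonneg (by norm_num) (Real.log_natCast_nonneg n)) (sq_nonneg _)
  have hdraw : (P.drawCount z v i : ℝ) + 1 ≤ #(P.component v) := by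
    exact_mod_cast drawCount_lt_card_component z i hv
  have hle : (#(samples A (P.component v) i n) : ℝ) ≤
      P.drawCount z v i + #(P.component v) * playCount A v i n := by
    exact_mod_cast hΦ.card_samples_le z x i n hv
  refine hle.trans <| le_add_mul_count
    (f := fun t => (P.drawCount z v i : ℝ) + #(P.component v) * playCount A v i t)
    (Nat.cast_nonneg _) ?_ fun t ht => ?_
  · simp only [playCount, Nat.count_zero]
    push_cast
    linarith
  by_cases hplay : A t v = i
  swap
  · left
    simp [playCount, Nat.count_succ, hplay]
  right
  have hsucc : (playCount A v i (t + 1) : ℝ) = playCount A v i t + 1 := by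
    simp [playCount, Nat.count_succ, hplay]
  simp only [hsucc, mul_add, mul_one, ← add_assoc]
  rcases lt_or_ge t K with htK | htK
  · left
    have hti : t ≤ i := (congrArg Fin.val
      ((hΦ.action_leader_of_lt z x hv htK).symm.trans hplay)).le
    rw [hΦ.playCount_leader_eq_zero z x i hv hti]
    push_cast
    linarith
  by_cases hmis : IsMisestimated P v (Φ.history z x t v) i μi ∨
      IsMisestimated P v (Φ.history z x t v) j μj
  · exact Or.inr ⟨⟨htK, hmis⟩, le_rfl⟩
  · left
    obtain ⟨hi, hj⟩ := not_or.1 hmis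
    have hfew := hΦ.drawCount_add_mul_playCount_lt z x hv hμ htK hplay hi hj
    have hmono : 8 * Real.log t / (μj - μi) ^ 2 ≤ 8 * Real.log n / (μj - μi) ^ 2 := by
      have ht0 : (0 : ℝ) < t := by exact_mod_cast (Nat.zero_le i).trans_lt (i.2.trans_le htK)
      gcongr
    linarith

end IsFYL

end FollowYourLeader

section Sampling

variable {V Ω : Type*} {G : SimpleGraph V} {K : ℕ}

theorem NetworkPolicy.measurable_action (Φ : NetworkPolicy G K) {mΩ : MeasurableSpace Ω}
    {z : Ω → V → Fin K} {x : Ω → ℕ → V → Fin K → ℝ} (hz : ∀ v, Measurable fun ω => z ω v) (t : ℕ)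
    (hx : ∀ s < t, ∀ v i, Measurable fun ω => x ω s v i) (v : V) :
    Measurable fun ω => Φ.action (z ω) (x ω) t v := by
  induction t using Nat.strong_induction_on generalizing v with
  | _ t ih =>
    have hhistory : Measurable fun ω => Φ.history (z ω) (x ω) t v := by
      refine measurable_pi_iff.2 fun s => measurable_pi_iff.2 fun u => ?_
      have haction := ih s s.2 (fun r hr => hx r (hr.trans s.2)) u
      have hreward : Measurable fun q : Ω × Fin K => x q.1 s u q.2 :=
        measurable_from_prod_countable_left fun i => hx s s.2 u i
      exact haction.prodMk (hreward.comp (measurable_id.prodMk haction))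
    simp_rw [Φ.action_eq_choice]
    exact (Φ.measurable_choice v t).comp ((hz v).prodMk hhistory)

variable {mΩ : MeasurableSpace Ω} {Pr : Measure Ω} {ν : Fin K → Measure ℝ}
  {X : ℕ → V → Fin K → Ω → ℝ} {Z : V → Ω → Fin K}

/-- The information carried by the reward with index `p = (t, v, i)`, the one that user `v` receives
in round `t` if it plays arm `i`. -/
@[reducible]
def rewardInfo (X : ℕ → V → Fin K → Ω → ℝ) (p : ℕ × V × Fin K) : MeasurableSpace Ω :=
  .comap (X p.1 p.2.1 p.2.2) inferInstance

/-- The time stamp of the reward with index `(t, v, i)`, which lists the users of a round one after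
the other. -/
def rewardTime (p : ℕ × V × Fin K) : ℕ ×ₗ V := toLex (p.1, p.2.1)

namespace IsEnvironment

variable (hXZ : IsEnvironment Pr ν X Z)
include hXZ

theorem isProbabilityMeasure : IsProbabilityMeasure Pr :=
  hXZ.indep_rewards.isProbabilityMeasure

theorem isPredictableSample [LinearOrder V] (Φ : NetworkPolicy G K) (z : V → Fin K)
    (C : Finset V) (i : Fin K) (t : ℕ) :
    IsPredictableSample (rewardInfo X) rewardTime (Finset.range t ×ˢ C ×ˢ {i})
      (fun ω => samples (Φ.action z fun t v i => X t v i ω) C i t) Pr where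
  le p := (hXZ.measurable_reward _ _ _).comap_le
  iIndep := (iIndepFun_iff_iIndep _ _ _).1 hXZ.indep_rewards
  injOn := by
    rintro ⟨s, u, k⟩ hp ⟨s', u', k'⟩ hq heq
    simp_all [rewardTime]
  subset ω := Finset.filter_subset _ _
  measurableSet_mem := by
    rintro ⟨s, u, k⟩ hp
    have haction := Φ.measurable_action (mΩ := strictPast (rewardInfo X) rewardTime
      (rewardTime (s, u, k))) (z := fun _ => z) (x := fun ω t v i => X t v i ω)
      (fun _ => measurable_const) s (fun r hr v j => ?_) u
    · simp only [samples, Finset.mem_filter, hp, true_and]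
      exact haction (measurableSet_singleton i)
    · have hpast : rewardTime (r, v, j) < rewardTime (s, u, k) :=
        Prod.Lex.toLex_lt_toLex.2 (Or.inl hr)
      exact (comap_measurable (X r v j)).mono (le_strictPast (m := rewardInfo X) hpast) le_rfl

theorem measurable_card_samples (Φ : NetworkPolicy G K) (z : V → Fin K) (C : Finset V)
    (i : Fin K) (t : ℕ) :
    Measurable fun ω => #(samples (Φ.action z fun t v i => X t v i ω) C i t) := by
  obtain ⟨_, -⟩ := exists_wellFoundedLT V
  exact (hXZ.isPredictableSample Φ z C i t).measurable_card

theorem hasSubgaussianMGF_reward {c : ℝ≥0}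
    (hν : ∀ i, HasSubgaussianMGF (fun y => y - armMean ν i) c (ν i)) (t : ℕ) (v : V) (i : Fin K) :
    HasSubgaussianMGF (fun ω => X t v i ω - armMean ν i) c Pr :=
  .of_map (X := fun y => y - armMean ν i) (hXZ.measurable_reward t v i).aemeasurable
    ((hXZ.reward_law t v i).symm ▸ hν i)

end IsEnvironment

end Sampling

section Misestimation

variable {V Ω : Type*} [Fintype V] {G : SimpleGraph V} {D : Finset V} {K : ℕ}

theorem isMisestimated_history_iff {P : DominatingSetPartition G D} {Φ : NetworkPolicy G K}
    {z : V → Fin K} {x : ℕ → V → Fin K → ℝ} {v : V} {t : ℕ} {i : Fin K} (μ : Fin K → ℝ)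
    (hne : (samples (Φ.action z x) (P.component v) i t).Nonempty) :
    IsMisestimated P v (Φ.history z x t v) i (μ i) ↔
      √(2 * Real.log t / #(samples (Φ.action z x) (P.component v) i t)) ≤
        |(∑ p ∈ samples (Φ.action z x) (P.component v) i t, (x p.1 p.2.1 p.2.2 - μ p.2.2)) /
          #(samples (Φ.action z x) (P.component v) i t)| := by
  have harm : ∀ p ∈ samples (Φ.action z x) (P.component v) i t, μ p.2.2 = μ i := fun p hp => by
    simp only [samples, Finset.mem_filter, Finset.mem_product, Finset.mem_singleton] at hp
    rw [hp.1.2.2]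
  have hcard : (#(samples (Φ.action z x) (P.component v) i t) : ℝ) ≠ 0 :=
    Nat.cast_ne_zero.2 hne.card_ne_zero
  rw [IsMisestimated, sampleCount_history, sampleMean_history, Finset.sum_sub_distrib,
    Finset.sum_congr rfl harm, Finset.sum_const, nsmul_eq_mul, sub_div,
    mul_div_cancel_left₀ _ hcard]

variable {mΩ : MeasurableSpace Ω} {Pr : Measure Ω} {ν : Fin K → Measure ℝ}
  {X : ℕ → V → Fin K → Ω → ℝ} {Z : V → Ω → Fin K} {P : DominatingSetPartition G D}
  {Φ : NetworkPolicy G K}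

theorem IsEnvironment.measurableSet_isMisestimated (hXZ : IsEnvironment Pr ν X Z)
    (P : DominatingSetPartition G D) (Φ : NetworkPolicy G K) (z : V → Fin K) (v : V) (t : ℕ)
    (i : Fin K) (μ : ℝ) :
    MeasurableSet
      {ω | IsMisestimated P v (Φ.history z (fun t v i => X t v i ω) t v) i μ} := by
  obtain ⟨_, -⟩ := exists_wellFoundedLT V
  simp only [IsMisestimated, sampleCount_history, sampleMean_history]
  have hcard : Measurable fun ω =>
      (#(samples (Φ.action z fun t v i => X t v i ω) (P.component v) i t) : ℝ) :=
    measurable_from_top.comp (hXZ.measurable_card_samples Φ z _ i t)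
  have hsum := (hXZ.isPredictableSample Φ z (P.component v) i t).measurable_sum
    (f := fun p => X p.1 p.2.1 p.2.2) fun p => hXZ.measurable_reward _ _ _
  exact measurableSet_le (hcard.const_div _).sqrt ((hsum.div hcard).sub_const _).abs

namespace IsFYL

variable (hΦ : IsFYL P Φ) (hXZ : IsEnvironment Pr ν X Z)
  (hν : ∀ i, HasSubgaussianMGF (fun y => y - armMean ν i) (1 / 4) (ν i)) (z : V → Fin K) {v : V}
  (hv : v ∈ D)
include hΦ hXZ hν hv

theorem measureReal_isMisestimated_le {t : ℕ} (ht : K ≤ t) (i : Fin K) :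
    Pr.real {ω | IsMisestimated P v (Φ.history z (fun t v i => X t v i ω) t v) i (armMean ν i)} ≤
      4 / (t : ℝ) ^ 3 := by
  obtain ⟨_, -⟩ := exists_wellFoundedLT V
  have ht0 : 0 < t := (Nat.zero_le i).trans_lt (i.2.trans_le ht)
  obtain ⟨R, hR, hmem⟩ := hΦ.exists_card_samples_mem z i hv ht0.ne'
  have hdeviation := (hXZ.isPredictableSample Φ z (P.component v) i t).measureReal_sqrt_le_abs_mean
    (ξ := fun p ω => X p.1 p.2.1 p.2.2 ω - armMean ν p.2.2)
    (fun p => (comap_measurable _).sub_const _)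
    (fun p => hXZ.hasSubgaussianMGF_reward hν p.1 p.2.1 p.2.2) (by norm_num)
    (fun ω => hΦ.samples_nonempty z _ i hv ht) (fun ω => hmem _)
    (L := 4 * Real.log t) (mul_nonneg (by norm_num) (Real.log_natCast_nonneg t))
  have hradius : 2 * ((1 / 4 : ℝ≥0) : ℝ) * (4 * Real.log t) = 2 * Real.log t := by
    push_cast
    ring
  simp only [hradius] at hdeviation
  simp_rw [isMisestimated_history_iff (armMean ν) (hΦ.samples_nonempty z _ i hv ht)]
  calc _ ≤ #R * (2 * Real.exp (-(4 * Real.log t))) := hdeviation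
    _ ≤ (2 * t : ℕ) * (2 * Real.exp (-(4 * Real.log t))) := by gcongr
    _ = (2 * t : ℕ) * (2 * ((t : ℝ) ^ 4)⁻¹) := by
      rw [Real.exp_neg, ← Nat.cast_ofNat (n := 4), Real.exp_nat_mul,
        Real.exp_log (Nat.cast_pos.2 ht0)]
    _ = 4 / (t : ℝ) ^ 3 := by
      push_cast
      field

theorem sum_measureReal_isMisestimated_le {i j : Fin K} (hij : i ≠ j) (n : ℕ) :
    ∑ t ∈ Finset.range n, Pr.real {ω | K ≤ t ∧
      (IsMisestimated P v (Φ.history z (fun t v i => X t v i ω) t v) i (armMean ν i) ∨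
        IsMisestimated P v (Φ.history z (fun t v i => X t v i ω) t v) j (armMean ν j))} ≤ 2 := by
  have := hXZ.isProbabilityMeasure
  have hK : 2 ≤ K := by
    have := Fin.val_ne_of_ne hij
    omega
  have hreach : ∀ t ∈ Finset.range n, t ∉ Finset.Ico 2 n → ¬ K ≤ t := fun t ht ht' => by
    rw [Finset.mem_range] at ht
    rw [Finset.mem_Ico] at ht'
    omega
  rw [← Finset.sum_subset (s₁ := Finset.Ico 2 n) (fun t ht => by simp_all)
    fun t ht ht' => by simp [hreach t ht ht']]
  calc _ ≤ ∑ t ∈ Finset.Ico 2 n, 8 * (1 / (t : ℝ) ^ 3) := Finset.sum_le_sum fun t _ => ?_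
    _ ≤ 8 * (1 / 4) := by
      rw [← Finset.mul_sum]
      gcongr
      exact sum_Ico_inv_cube_le n
    _ = 2 := by norm_num
  rcases lt_or_ge t K with htK | htK
  · simp [htK.not_ge]
  simp only [htK, true_and]
  calc _ ≤ _ := measureReal_union_le _ _
    _ ≤ 4 / (t : ℝ) ^ 3 + 4 / (t : ℝ) ^ 3 := add_le_add
      (hΦ.measureReal_isMisestimated_le hXZ hν z hv htK i)
      (hΦ.measureReal_isMisestimated_le hXZ hν z hv htK j)
    _ = 8 * (1 / (t : ℝ) ^ 3) := by ring

theorem integral_card_samples_le {i j : Fin K} (hij : armMean ν i < armMean ν j) (n : ℕ) :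
    ∫ ω, (#(samples (Φ.action z fun t v i => X t v i ω) (P.component v) i n) : ℝ) ∂Pr ≤
      8 * Real.log n / (armMean ν j - armMean ν i) ^ 2 + (4 * #(P.component v) - 1) := by
  classical
  have := hXZ.isProbabilityMeasure
  set E : ℕ → Set Ω := fun t => {ω | K ≤ t ∧
    (IsMisestimated P v (Φ.history z (fun t v i => X t v i ω) t v) i (armMean ν i) ∨
      IsMisestimated P v (Φ.history z (fun t v i => X t v i ω) t v) j (armMean ν j))}
  have hE : ∀ t, MeasurableSet (E t) := fun t => (MeasurableSet.const _).inter
    ((hXZ.measurableSet_isMisestimated P Φ z v t i _).union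
      (hXZ.measurableSet_isMisestimated P Φ z v t j _))
  set b : ℝ := 8 * Real.log n / (armMean ν j - armMean ν i) ^ 2 + (2 * #(P.component v) - 1)
  have hcount : Integrable (fun ω => #(P.component v) *
      (Nat.count (fun t => ω ∈ E t) n : ℝ)) Pr := (integrable_count_mem hE n).const_mul _
  calc _ ≤ ∫ ω, (b + #(P.component v) * (Nat.count (fun t => ω ∈ E t) n : ℝ)) ∂Pr :=
      integral_mono_of_nonneg (.of_forall fun ω => Nat.cast_nonneg _)
        ((integrable_const b).add hcount)
        (.of_forall fun ω => hΦ.card_samples_le_add_count z _ i hv hij n)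
    _ = b + #(P.component v) * ∑ t ∈ Finset.range n, Pr.real (E t) := by
      rw [integral_add (integrable_const b) hcount, integral_const_mul, integral_count_mem hE]
      simp
    _ ≤ b + #(P.component v) * 2 := by
      gcongr
      exact hΦ.sum_measureReal_isMisestimated_le hXZ hν z hv (fun h => hij.ne (congrArg _ h)) n
    _ = _ := by
      simp only [b]
      ring

end IsFYL

end Misestimation

section Regret

variable {V Ω : Type*} [Fintype V] {G : SimpleGraph V} {D : Finset V} {K : ℕ}

theorem gap_nonneg (ν : Fin K → Measure ℝ) (i : Fin K) : 0 ≤ gap ν i :=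
  sub_nonneg.2 (le_ciSup (Set.finite_range (armMean ν)).bddAbove i)

theorem networkRegret_eq_sum_gap_mul (P : DominatingSetPartition G D) (ν : Fin K → Measure ℝ)
    (Φ : NetworkPolicy G K) (z : V → Fin K) (x : ℕ → V → Fin K → ℝ) (n : ℕ) :
    networkRegret ν Φ z x n =
      ∑ i, gap ν i * ∑ v ∈ D, (#(samples (Φ.action z x) (P.component v) i n) : ℝ) := by
  have huser : ∀ u, ∑ t ∈ Finset.range n, (optMean ν - armMean ν (Φ.action z x t u)) =
      ∑ i, gap ν i * playCount (Φ.action z x) u i n := fun u => by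
    simp only [playCount, Nat.count_eq_card_filter_range]
    rw [← Finset.sum_fiberwise _ fun t => Φ.action z x t u]
    refine Finset.sum_congr rfl fun i _ => ?_
    rw [Finset.sum_congr rfl fun t ht => by rw [(Finset.mem_filter.1 ht).2], Finset.sum_const,
      nsmul_eq_mul, mul_comm, gap]
  simp only [networkRegret, huser, card_samples, Nat.cast_sum]
  rw [Finset.sum_comm]
  exact Finset.sum_congr rfl fun i _ => by rw [← Finset.mul_sum, P.sum_univ]

variable {mΩ : MeasurableSpace Ω} {Pr : Measure Ω} {ν : Fin K → Measure ℝ}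
  {X : ℕ → V → Fin K → Ω → ℝ} {Z : V → Ω → Fin K} {P : DominatingSetPartition G D}
  {Φ : NetworkPolicy G K}

theorem measurable_networkRegret {z : Ω → V → Fin K} {x : Ω → ℕ → V → Fin K → ℝ}
    (hz : ∀ v, Measurable fun ω => z ω v) (hx : ∀ t v i, Measurable fun ω => x ω t v i) (n : ℕ) :
    Measurable fun ω => networkRegret ν Φ (z ω) (x ω) n :=
  Finset.measurable_sum _ fun v _ => Finset.measurable_sum _ fun t _ =>
    (measurable_from_top (f := fun i : Fin K => optMean ν - armMean ν i)).comp
      (Φ.measurable_action hz t (fun s _ => hx s) v)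

theorem integrable_networkRegret [IsFiniteMeasure Pr] {z : Ω → V → Fin K}
    {x : Ω → ℕ → V → Fin K → ℝ} (hz : ∀ v, Measurable fun ω => z ω v)
    (hx : ∀ t v i, Measurable fun ω => x ω t v i) (n : ℕ) :
    Integrable (fun ω => networkRegret ν Φ (z ω) (x ω) n) Pr := by
  refine .of_bound (measurable_networkRegret hz hx n).aestronglyMeasurable
    (∑ _v : V, ∑ _t ∈ Finset.range n, ∑ i, gap ν i) (.of_forall fun ω => ?_)
  have hnonneg : 0 ≤ networkRegret ν Φ (z ω) (x ω) n :=
    Finset.sum_nonneg fun _ _ => Finset.sum_nonneg fun _ _ => gap_nonneg ν _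
  rw [Real.norm_of_nonneg hnonneg]
  exact Finset.sum_le_sum fun _ _ => Finset.sum_le_sum fun _ _ =>
    Finset.single_le_sum (fun i _ => gap_nonneg ν i) (Finset.mem_univ _)

namespace IsFYL

variable (hΦ : IsFYL P Φ) (hXZ : IsEnvironment Pr ν X Z)
  (hν : ∀ i, HasSubgaussianMGF (fun y => y - armMean ν i) (1 / 4) (ν i))
include hΦ hXZ hν

theorem gap_mul_sum_integral_card_samples_le (z : V → Fin K) {i : Fin K}
    (hi : armMean ν i < optMean ν) (n : ℕ) :
    gap ν i * ∑ v ∈ D,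
        ∫ ω, (#(samples (Φ.action z fun t v i => X t v i ω) (P.component v) i n) : ℝ) ∂Pr ≤
      8 * #D * Real.log n / gap ν i + (4 * Fintype.card V - #D) * gap ν i := by
  have hgap : 0 < gap ν i := sub_pos.2 hi
  have : Nonempty (Fin K) := ⟨i⟩
  obtain ⟨j, hj⟩ := exists_eq_ciSup_of_finite (f := armMean ν)
  have hj : armMean ν j = optMean ν := hj
  have hcard : (∑ v ∈ D, #(P.component v) : ℝ) = Fintype.card V := by
    exact_mod_cast P.sum_card_component
  calc _ ≤ gap ν i * ∑ v ∈ D,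
        (8 * Real.log n / gap ν i ^ 2 + (4 * #(P.component v) - 1 : ℝ)) := by
        gcongr with v hv
        rw [gap, ← hj]
        exact hΦ.integral_card_samples_le hXZ hν z hv (hi.trans_eq hj.symm) n
    _ = gap ν i * (#D * (8 * Real.log n / gap ν i ^ 2) + (4 * Fintype.card V - #D)) := by
      simp only [Finset.sum_add_distrib, Finset.sum_sub_distrib, ← Finset.mul_sum, hcard,
        Finset.sum_const, nsmul_eq_mul, mul_one]
    _ = _ := by field

theorem integral_networkRegret_le_of_fixed_draws (z : V → Fin K) (n : ℕ) :
    ∫ ω, networkRegret ν Φ z (fun t v i => X t v i ω) n ∂Pr ≤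
      (∑ i with armMean ν i < optMean ν, 8 * #D * Real.log n / gap ν i) +
        (4 * Fintype.card V - #D) * ∑ j, gap ν j := by
  have := hXZ.isProbabilityMeasure
  have hint : ∀ v i, Integrable (fun ω =>
      (#(samples (Φ.action z fun t v i => X t v i ω) (P.component v) i n) : ℝ)) Pr :=
    fun v i => .of_bound (measurable_from_top.comp
      (hXZ.measurable_card_samples Φ z (P.component v) i n)).aestronglyMeasurable
      #(Finset.range n ×ˢ P.component v ×ˢ {i}) (.of_forall fun ω => by
        rw [Real.norm_natCast]
        exact Nat.cast_le.2 (Finset.card_filter_le _ _))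
  simp_rw [networkRegret_eq_sum_gap_mul P]
  rw [integral_finsetSum _ fun i _ => (integrable_finsetSum _ fun v _ => hint v i).const_mul _,
    Finset.mul_sum, Finset.sum_filter, ← Finset.sum_add_distrib]
  refine Finset.sum_le_sum fun i _ => ?_
  rw [integral_const_mul, integral_finsetSum _ fun v _ => hint v i]
  split_ifs with hi
  · exact hΦ.gap_mul_sum_integral_card_samples_le hXZ hν z hi n
  · have hgap : gap ν i = 0 := le_antisymm (sub_nonpos.2 (not_lt.1 hi)) (gap_nonneg ν i)
    simp [hgap]

end IsFYL

end Regret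

theorem hasSubgaussianMGF_sub_integral_of_mem_Icc {ρ : Measure ℝ} [IsProbabilityMeasure ρ]
    (hρ : ∀ᵐ y ∂ρ, y ∈ Set.Icc (0 : ℝ) 1) :
    HasSubgaussianMGF (fun y => y - ∫ x, x ∂ρ) (1 / 4) ρ := by
  have hquarter : (‖(1 : ℝ) - 0‖₊ / 2) ^ 2 = 1 / 4 := by norm_num
  exact hquarter ▸ hasSubgaussianMGF_of_mem_Icc (X := id) aemeasurable_id hρ

section Constant

theorem one_le_one_div_mul_one_add_inv_log {β : ℝ} (hβ : β ∈ Set.Ioo (1 / 4 : ℝ) 1) :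
    1 ≤ 1 / (4 * β - 1) * (1 + 1 / ((4 * β - 1) * Real.log (1 / β))) := by
  obtain ⟨hquarter, hone⟩ := hβ
  have hβ0 : 0 < β := by linarith
  have hx : 0 < 4 * β - 1 := by linarith
  have hlog : 0 < Real.log (1 / β) := Real.log_pos (by rwa [lt_div_iff₀ hβ0, one_mul])
  have hlog_le : Real.log (1 / β) * β ≤ 1 - β := by
    rw [← le_div_iff₀ hβ0, sub_div, div_self hβ0.ne']
    exact Real.log_le_sub_one_of_pos (by positivity)
  have hratio : β / ((4 * β - 1) * (1 - β)) ≤ 1 / ((4 * β - 1) * Real.log (1 / β)) := by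
    rw [div_le_div_iff₀ (by nlinarith) (by positivity)]
    nlinarith
  have hpoly : 4 * β - 2 ≤ β / ((4 * β - 1) * (1 - β)) := by
    rw [le_div_iff₀ (by nlinarith)]
    nlinarith [mul_nonneg hx.le (sq_nonneg (4 * β - 3))]
  rw [one_div_mul_eq_div, le_div_iff₀ hx]
  linarith

theorem DominatingSetPartition.one_le_card {V : Type*} [Nonempty V] {G : SimpleGraph V}
    {D : Finset V} (P : DominatingSetPartition G D) : 1 ≤ #D :=
  Finset.one_le_card.2 ⟨_, P.leader_mem (Classical.arbitrary V)⟩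

theorem DominatingSetPartition.regret_constant_le {V : Type*} [Fintype V] [Nonempty V]
    {G : SimpleGraph V} {D : Finset V} (P : DominatingSetPartition G D) {K : ℕ}
    (ν : Fin K → Measure ℝ) {β : ℝ} (hβ : β ∈ Set.Ioo (1 / 4 : ℝ) 1) (c : ℝ) :
    c + (4 * (Fintype.card V : ℝ) - #D) * ∑ j, gap ν j ≤
      c + (2 * (Fintype.card V : ℝ) - 1 + 2 * (Fintype.card V : ℝ) / (4 * β - 1) *
        (1 + 1 / ((4 * β - 1) * Real.log (1 / β)))) * ∑ j, gap ν j := by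
  have hgap : 0 ≤ ∑ j, gap ν j := Finset.sum_nonneg fun j _ => gap_nonneg ν j
  have hleaders : (1 : ℝ) ≤ #D := mod_cast P.one_le_card
  have hconstant := mul_le_mul_of_nonneg_left (one_le_one_div_mul_one_add_inv_log hβ)
    (by positivity : (0 : ℝ) ≤ 2 * Fintype.card V)
  gcongr
  rw [div_eq_mul_one_div, mul_assoc]
  linarith

end Constant

end NetworkBandit

theorem theorem6_general {V : Type*} [Fintype V] {G : SimpleGraph V} {D : Finset V}
    {P : NetworkBandit.DominatingSetPartition G D} {K : ℕ} {ν : Fin K → Measure ℝ}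
    (hν : ∀ i, HasSubgaussianMGF (fun y => y - NetworkBandit.armMean ν i) (1 / 4) (ν i))
    {Ω : Type*} [MeasurableSpace Ω] {Pr : Measure Ω} {X : ℕ → V → Fin K → Ω → ℝ}
    {Z : V → Ω → Fin K} (hXZ : NetworkBandit.IsEnvironment Pr ν X Z)
    {Φ : NetworkBandit.NetworkPolicy G K} (hΦ : NetworkBandit.IsFYL P Φ) (n : ℕ) :
    Integrable (fun ω => NetworkBandit.networkRegret ν Φ (fun v => Z v ω)
      (fun t v i => X t v i ω) n) Pr ∧
    ∫ ω, NetworkBandit.networkRegret ν Φ (fun v => Z v ω) (fun t v i => X t v i ω) n ∂Pr ≤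
      (∑ i with NetworkBandit.armMean ν i < NetworkBandit.optMean ν,
        8 * (D.card : ℝ) * Real.log n / NetworkBandit.gap ν i) +
      (4 * (Fintype.card V : ℝ) - D.card) * ∑ j, NetworkBandit.gap ν j := by
  have := hXZ.isProbabilityMeasure
  have hint : Integrable (fun ω => NetworkBandit.networkRegret ν Φ (fun v => Z v ω)
      (fun t v i => X t v i ω) n) Pr :=
    NetworkBandit.integrable_networkRegret hXZ.measurable_draw hXZ.measurable_reward n
  refine ⟨hint, NetworkBandit.integral_comp_le_of_indepFun
    (Z := fun ω v => Z v ω) (X := fun ω (p : ℕ × V × Fin K) => X p.1 p.2.1 p.2.2 ω)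
    (F := fun z x => NetworkBandit.networkRegret ν Φ z (fun t v i => x (t, v, i)) n)
    (measurable_pi_iff.2 hXZ.measurable_draw)
    (measurable_pi_iff.2 fun p => hXZ.measurable_reward p.1 p.2.1 p.2.2) hXZ.indep_draws
    ?_ hint fun z => hΦ.integral_networkRegret_le_of_fixed_draws hXZ hν z n⟩
  exact NetworkBandit.measurable_networkRegret
    (fun v => (measurable_pi_apply v).comp measurable_fst)
    (fun t v i => (measurable_pi_apply (t, v, i)).comp measurable_snd) n

theorem theorem6 {V : Type*} [Fintype V] [Nonempty V] (G : SimpleGraph V)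
    (D : Finset V) (_hD : NetworkBandit.IsDominatingSet G D)
    (P : NetworkBandit.DominatingSetPartition G D)
    {K : ℕ} [NeZero K] (ν : Fin K → Measure ℝ) [∀ i, IsProbabilityMeasure (ν i)]
    (hν : ∀ i, ∀ᵐ y ∂(ν i), y ∈ Set.Icc (0 : ℝ) 1)
    {Ω : Type*} [MeasurableSpace Ω] (Pr : Measure Ω) [IsProbabilityMeasure Pr]
    (X : ℕ → V → Fin K → Ω → ℝ) (Z : V → Ω → Fin K)
    (hXZ : NetworkBandit.IsEnvironment Pr ν X Z)
    (Φ : NetworkBandit.NetworkPolicy G K) (hΦ : NetworkBandit.IsFYL P Φ)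
    (n : ℕ) (β : ℝ) (hβ : β ∈ Set.Ioo (1 / 4 : ℝ) 1) :
    Integrable (fun ω => NetworkBandit.networkRegret ν Φ (fun v => Z v ω)
      (fun t v i => X t v i ω) n) Pr ∧
    ∫ ω, NetworkBandit.networkRegret ν Φ (fun v => Z v ω) (fun t v i => X t v i ω) n ∂Pr ≤
      (∑ i with NetworkBandit.armMean ν i < NetworkBandit.optMean ν,
        8 * (D.card : ℝ) * Real.log n / NetworkBandit.gap ν i) +
      (2 * (Fintype.card V : ℝ) - 1 + 2 * (Fintype.card V : ℝ) / (4 * β - 1) *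
        (1 + 1 / ((4 * β - 1) * Real.log (1 / β)))) * ∑ j, NetworkBandit.gap ν j :=
  (theorem6_general (fun i => NetworkBandit.hasSubgaussianMGF_sub_integral_of_mem_Icc (hν i)) hXZ
    hΦ n).imp_right fun h => h.trans (P.regret_constant_le ν hβ _)
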